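/- For a topological field $K$ and nonzero $z,q\in K$ put $\theta(z,q)=\sum_{n\in\mathbb Z} q^{n^2}z^n$ (the Jacobi theta function), whenever the series converges. Let $m\ge 1$, let $q\in\mathbb Q^*$, and let $\xi_1,\dots,\xi_m,\gamma_1,\dots,\gamma_m$ be nonzero rational numbers such that the $2m$ elements $\xi_1,\xi_1^{-1},\dots,\xi_m,\xi_m^{-1}$ have pairwise distinct classes in the quotient group $\mathbb Q^*/q^{\mathbb Z}$. (i) If $q=1/n$ with $n>1$ an integer, then the series $\theta(\xi_i,q)$ converge in $\mathbb R$ and the real number $\gamma_1\theta(\xi_1,q)+\dots+\gamma_m\theta(\xi_m,q)$ is irrational. (ii) If $p$ is a prime number and $q>1$ is a rational number whose numerator (in lowest terms) is $p^k$ for some integer $k\ge 1$, then the series $\theta(\xi_i,q)$ converge in $\mathbb Q_p$ and the $p$-adic number $\gamma_1\theta(\xi_1,q)+\dots+\gamma_m\theta(\xi_m,q)$ is irrational, that is, it does not belong to $\mathbb Q\subset\mathbb Q_p$. -/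

import Mathlib

/-- The `n`-th term `q ^ (n ^ 2) * z ^ n` (`n ∈ ℤ`) of the Jacobi theta series. -/
def thetaTerm {K : Type*} [Field K] (z q : K) (n : ℤ) : K :=
  q ^ (n ^ 2) * z ^ n

/-- The Jacobi theta function `θ(z, q) = ∑_{n ∈ ℤ} q ^ (n ^ 2) * z ^ n` over a topological field
(used below for `ℝ` and for `ℚ_[p]`). -/
noncomputable def jacobiThetaSeries {K : Type*} [Field K] [TopologicalSpace K] (z q : K) : K :=
  ∑' n : ℤ, thetaTerm z q n

/-- The `2 m` elements `ξ i` and `(ξ i)⁻¹` (indexed by `i` and a sign `ε ∈ {1, -1} = ℤˣ`)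
have pairwise distinct classes in the quotient group `ℚˣ / q ^ ℤ`. -/
def DistinctClasses {m : ℕ} (q : ℚˣ) (ξ : Fin m → ℚˣ) : Prop :=
  Function.Injective fun a : Fin m × ℤˣ =>
    (QuotientGroup.mk (ξ a.1 ^ (a.2 : ℤ)) : ℚˣ ⧸ Subgroup.zpowers q)

open Filter Topology

/-! Each `θ(ξ i, q)` splits into two partial theta series, in `ξ i` and `(ξ i)⁻¹`, minus `1`. So a
rational combination yields a rational `S = ∑ j, c j * ∑ k, q ^ (k ^ 2) * α j ^ k`. Since `(N + k) ^
2 = N ^ 2 + 2 k N + k ^ 2`, its remainder after `N` terms, divided by `q ^ (N ^ 2)`, is an infinite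
sum of exponentials in `N` with bases `α j * q ^ (2 * k)` (`hasSum_thetaRemainder`). The bases are
distinct by the hypothesis on classes, and tend to zero.

A recurrence operator annihilating the finitely many large bases leaves a nonzero quantity smaller
than any prescribed exponential (`exists_recurrenceApply_small`). For `q = a / b` its denominator
divides `T * D ^ m * a ^ ((m + deg P) ^ 2)`. If `a = 1`, clearing it gives a nonzero integer of
absolute value below `1`. If `a = p ^ k`, the power of `p` cancels in the product of the real and
`p`-adic absolute values; as `q > 1` makes the real one at most exponential, the product is below
`1`, impossible for a nonzero integer. -/

/-- The linear recurrence operator with characteristic polynomial `P`, applied to `v` and evaluated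
at `m`. -/
def recurrenceApply (P : Polynomial ℚ) (v : ℕ → ℚ) (m : ℕ) : ℚ :=
  ∑ i ∈ Finset.range (P.natDegree + 1), P.coeff i * v (m + i)

/-! ### Infinite sums of exponentials and linear recurrences -/

section ExponentialSums

variable {K : Type*} [NormedField K] [CharZero K] {L : Type*} {w x : L → ℚ} {v : ℕ → ℚ}

/-- Each exponential `m ↦ x ^ m` is an eigenvector of the shift, so the operator multiplies it by
`P.eval x`. -/
lemma hasSum_recurrenceApply
    (hv : ∀ m, HasSum (fun l => ((w l * x l ^ m : ℚ) : K)) (v m : K)) (P : Polynomial ℚ) (m : ℕ) :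
    HasSum (fun l => ((w l * P.eval (x l) * x l ^ m : ℚ) : K)) (recurrenceApply P v m : K) := by
  have h := hasSum_sum (s := Finset.range (P.natDegree + 1))
    fun i _ => (hv (m + i)).mul_left ((P.coeff i : ℚ) : K)
  have hl : ∀ l, ((w l * P.eval (x l) * x l ^ m : ℚ) : K) =
      ∑ i ∈ Finset.range (P.natDegree + 1), (P.coeff i : K) * ((w l * x l ^ (m + i) : ℚ) : K) := by
    intro l
    rw [Polynomial.eval_eq_sum_range]
    push_cast
    rw [Finset.mul_sum, Finset.sum_mul]
    exact Finset.sum_congr rfl fun i _ => by ring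
  have hr : (recurrenceApply P v m : K) =
      ∑ i ∈ Finset.range (P.natDegree + 1), (P.coeff i : K) * (v (m + i) : K) := by
    simp [recurrenceApply]
  simp_rw [hl, hr]
  exact h

lemma summable_norm_mul_eval (hw : ∀ i : ℕ, Summable fun l => ‖((w l * x l ^ i : ℚ) : K)‖)
    (P : Polynomial ℚ) : Summable fun l => ‖((w l * P.eval (x l) : ℚ) : K)‖ := by
  have h := summable_sum (s := Finset.range (P.natDegree + 1))
    fun i _ => (hw i).mul_left ‖((P.coeff i : ℚ) : K)‖
  refine .of_nonneg_of_le (fun l => norm_nonneg _) (fun l => ?_) h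
  rw [Polynomial.eval_eq_sum_range, Finset.mul_sum, Rat.cast_sum]
  refine (norm_sum_le _ _).trans (Finset.sum_le_sum fun i _ => le_of_eq ?_)
  rw [← norm_mul]
  push_cast
  congr 1
  ring

/-- All bases at least as large as `x l₀` are killed, so the surviving ratios `x l / x l₀` have norm
below `1` and dominated convergence applies. -/
lemma tendsto_recurrenceApply_div [CompleteSpace K]
    (hv : ∀ m, HasSum (fun l => ((w l * x l ^ m : ℚ) : K)) (v m : K))
    (hw : ∀ i : ℕ, Summable fun l => ‖((w l * x l ^ i : ℚ) : K)‖)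
    (P : Polynomial ℚ) (l₀ : L) (hx₀ : x l₀ ≠ 0)
    (hP : ∀ l ≠ l₀, ‖(x l₀ : K)‖ ≤ ‖(x l : K)‖ → P.eval (x l) = 0) :
    Tendsto (fun m => (recurrenceApply P v m : K) / (x l₀ : K) ^ m) atTop
      (𝓝 ((w l₀ * P.eval (x l₀) : ℚ) : K)) := by
  classical
  have hx₀' : (x l₀ : K) ≠ 0 := by exact_mod_cast hx₀
  have hnorm : 0 < ‖(x l₀ : K)‖ := norm_pos_iff.2 hx₀'
  set b : L → K := fun l => ((w l * P.eval (x l) : ℚ) : K) with hb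
  have hterm : ∀ m, (recurrenceApply P v m : K) / (x l₀ : K) ^ m =
      ∑' l, b l * ((x l : K) / (x l₀ : K)) ^ m := by
    intro m
    rw [← ((hasSum_recurrenceApply hv P m).div_const _).tsum_eq]
    refine tsum_congr fun l => ?_
    rw [hb, div_pow]
    push_cast
    ring
  simp_rw [hterm]
  have hlim : b l₀ = ∑' l, if l = l₀ then b l₀ else 0 := by simp
  change Tendsto _ _ (𝓝 (b l₀))
  rw [hlim]
  refine tendsto_tsum_of_dominated_convergence (summable_norm_mul_eval hw P) (fun l => ?_)
    (.of_forall fun m l => ?_)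
  · split_ifs with h
    · subst h
      simp [div_self hx₀']
    · by_cases hl : ‖(x l₀ : K)‖ ≤ ‖(x l : K)‖
      · simp [hb, hP l h hl]
      · have : ‖(x l : K) / (x l₀ : K)‖ < 1 := by
          rw [norm_div, div_lt_one hnorm]
          exact not_le.1 hl
        simpa using (tendsto_pow_atTop_nhds_zero_of_norm_lt_one this).const_mul (b l)
  · by_cases h : l = l₀
    · subst h
      simp [div_self hx₀', hb]
    · by_cases hl : ‖(x l₀ : K)‖ ≤ ‖(x l : K)‖
      · simp [hb, hP l h hl]
      · rw [norm_mul, norm_pow, norm_div]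
        refine mul_le_of_le_one_right (norm_nonneg _) (pow_le_one₀ (by positivity) ?_)
        rw [div_le_one hnorm]
        exact (not_le.1 hl).le

/-- An infinite sum of exponentials with bases tending to zero admits linear recurrence operators
whose values are nonzero and decay faster than any prescribed exponential. -/
theorem exists_recurrenceApply_small [CompleteSpace K] [Infinite L]
    (hv : ∀ m, HasSum (fun l => ((w l * x l ^ m : ℚ) : K)) (v m : K))
    (hw : ∀ i : ℕ, Summable fun l => ‖((w l * x l ^ i : ℚ) : K)‖)
    (hfin : ∀ ε : ℝ, 0 < ε → {l | ε ≤ ‖(x l : K)‖}.Finite)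
    (hinj : Function.Injective x) (hw₀ : ∀ l, w l ≠ 0) (hx₀ : ∀ l, x l ≠ 0)
    {B : ℝ} (hB : 0 < B) :
    ∃ P : Polynomial ℚ, ∀ c : ℝ, 0 < c → ∃ m : ℕ, recurrenceApply P v m ≠ 0 ∧
      ‖(recurrenceApply P v m : K)‖ < c * B ^ m := by
  classical
  obtain ⟨l₀, hl₀⟩ := (hfin B hB).exists_notMem
  have hl₀ : ‖(x l₀ : K)‖ < B := not_le.1 hl₀
  have hx₀' : (x l₀ : K) ≠ 0 := by exact_mod_cast hx₀ l₀
  have hnorm : 0 < ‖(x l₀ : K)‖ := norm_pos_iff.2 hx₀'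
  -- Bases tied in norm with `x l₀` are killed too, so that `x l₀` strictly dominates what remains.
  set G := (hfin _ hnorm).toFinset.erase l₀ with hG
  set P : Polynomial ℚ := ∏ l ∈ G, (Polynomial.X - Polynomial.C (x l)) with hP
  have hPeval : ∀ y, P.eval y = ∏ l ∈ G, (y - x l) := fun y => by
    simp [hP, Polynomial.eval_prod]
  have hzero : ∀ l ≠ l₀, ‖(x l₀ : K)‖ ≤ ‖(x l : K)‖ → P.eval (x l) = 0 := by
    intro l hl hle
    rw [hPeval]
    exact Finset.prod_eq_zero (i := l) (by simp [hG, hl, hle]) (sub_self _)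
  have hne : w l₀ * P.eval (x l₀) ≠ 0 := by
    refine mul_ne_zero (hw₀ _) ?_
    rw [hPeval]
    refine Finset.prod_ne_zero_iff.2 fun l hl => sub_ne_zero.2 fun h => ?_
    exact (Finset.mem_erase.1 hl).1 (hinj h.symm)
  have hne' : ((w l₀ * P.eval (x l₀) : ℚ) : K) ≠ 0 := by exact_mod_cast hne
  have hlim := tendsto_recurrenceApply_div hv hw P l₀ (hx₀ l₀) hzero
  refine ⟨P, fun c hc => ?_⟩
  have hgeom : Tendsto (fun m : ℕ => (‖(x l₀ : K)‖ / B) ^ m) atTop (𝓝 0) :=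
    tendsto_pow_atTop_nhds_zero_of_lt_one (by positivity) ((div_lt_one hB).2 hl₀)
  have hprod := hlim.norm.mul hgeom
  rw [mul_zero] at hprod
  -- `P` was fixed before `c`; later `c` depends on denominators and bounds attached to `P`.
  obtain ⟨m, hm, hm'⟩ := ((hlim.eventually_ne hne').and (hprod.eventually (gt_mem_nhds hc))).exists
  refine ⟨m, fun h => hm (by simp [h]), ?_⟩
  rw [norm_div, norm_pow, div_pow, div_mul_div_cancel₀ (by positivity),
    div_lt_iff₀ (by positivity)] at hm'
  exact hm'

end ExponentialSums

/-! ### Partial theta series and their remainders -/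

lemma summable_pow_sq_mul_pow {r a : ℝ} (hr₀ : 0 ≤ r) (hr : r < 1) (ha : 0 ≤ a) :
    Summable fun k : ℕ => r ^ (k ^ 2) * a ^ k := by
  have hlim : Tendsto (fun k : ℕ => r ^ k * a) atTop (𝓝 0) := by
    simpa using (tendsto_pow_atTop_nhds_zero_of_lt_one hr₀ hr).mul_const a
  refine Summable.of_norm_bounded_eventually_nat (g := fun k => (1 / 2 : ℝ) ^ k)
    (summable_geometric_of_lt_one (by norm_num) (by norm_num)) ?_
  filter_upwards [hlim.eventually (gt_mem_nhds (by norm_num : (0 : ℝ) < 1 / 2))] with k hk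
  rw [Real.norm_of_nonneg (by positivity), sq, pow_mul, ← mul_pow]
  exact pow_le_pow_left₀ (by positivity) hk.le k

section PartialTheta

variable {K : Type*} [NormedField K] [CompleteSpace K]

lemma summable_partialTheta {q : K} (hq : ‖q‖ < 1) (z : K) :
    Summable fun k : ℕ => q ^ (k ^ 2) * z ^ k :=
  .of_norm (by simpa using summable_pow_sq_mul_pow (norm_nonneg q) hq (norm_nonneg z))

lemma hasSum_thetaTerm {q : K} (hq : ‖q‖ < 1) (z : K) :
    HasSum (thetaTerm z q) ((∑' k : ℕ, q ^ (k ^ 2) * z ^ k) +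
      (∑' k : ℕ, q ^ (k ^ 2) * z⁻¹ ^ k) - 1) := by
  have h := HasSum.of_nat_of_neg (f := thetaTerm z q)
    (g := ∑' k : ℕ, q ^ (k ^ 2) * z ^ k) (g' := ∑' k : ℕ, q ^ (k ^ 2) * z⁻¹ ^ k)
    ((summable_partialTheta hq z).hasSum.congr_fun fun k => by
      simp only [thetaTerm]
      norm_cast)
    ((summable_partialTheta hq z⁻¹).hasSum.congr_fun fun k => by
      simp only [thetaTerm, neg_sq, zpow_neg, inv_pow]
      norm_cast)
  simpa [thetaTerm] using h

end PartialTheta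

/-- The remainder after `N` terms of an expansion of `S` as a combination of partial theta series,
divided by `q ^ (N ^ 2)`. -/
def thetaRemainder {J : Type*} [Fintype J] (q S : ℚ) (c α : J → ℚ) (N : ℕ) : ℚ :=
  (q ^ (N ^ 2))⁻¹ * (S - ∑ n ∈ Finset.range N, q ^ (n ^ 2) * ∑ j, c j * α j ^ n)

section Remainder

variable {K : Type*} [NormedField K] [CharZero K] {J : Type*} [Fintype J]
  {q S : ℚ} {c α : J → ℚ}

lemma summable_norm_thetaExponentials (hq : ‖(q : K)‖ < 1) (c α : J → ℚ) (N : ℕ) :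
    Summable fun l : J × ℕ => ‖((c l.1 * q ^ (l.2 ^ 2) * α l.1 ^ l.2 *
      (α l.1 * q ^ (2 * l.2)) ^ N : ℚ) : K)‖ := by
  refine (summable_prod_of_nonneg fun _ => norm_nonneg _).2 ⟨fun j => ?_, .of_finite⟩
  refine ((summable_pow_sq_mul_pow (norm_nonneg (q : K)) hq
    (by positivity : 0 ≤ ‖(α j : K)‖ * ‖(q : K)‖ ^ (2 * N))).mul_left
      (‖(c j : K)‖ * ‖(α j : K)‖ ^ N)).congr fun k => ?_
  push_cast
  simp only [norm_mul, norm_pow]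
  ring

lemma hasSum_thetaRemainder [CompleteSpace K] (hq₀ : q ≠ 0) (hq : ‖(q : K)‖ < 1)
    (hS : (S : K) = ∑ j, (c j : K) * ∑' k : ℕ, (q : K) ^ (k ^ 2) * (α j : K) ^ k) (N : ℕ) :
    HasSum (fun l : J × ℕ => ((c l.1 * q ^ (l.2 ^ 2) * α l.1 ^ l.2 *
      (α l.1 * q ^ (2 * l.2)) ^ N : ℚ) : K)) (thetaRemainder q S c α N : K) := by
  have hq₀' : (q : K) ≠ 0 := by exact_mod_cast hq₀
  have hsum := Summable.of_norm (summable_norm_thetaExponentials hq c α N)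
  have hfiber : ∀ j, HasSum (fun k : ℕ => ((c j * q ^ (k ^ 2) * α j ^ k *
      (α j * q ^ (2 * k)) ^ N : ℚ) : K)) (((q : K) ^ (N ^ 2))⁻¹ * (c j *
        ((∑' k : ℕ, (q : K) ^ (k ^ 2) * (α j : K) ^ k) -
          ∑ n ∈ Finset.range N, (q : K) ^ (n ^ 2) * (α j : K) ^ n))) := by
    intro j
    have h := (((hasSum_nat_add_iff' N).2 (summable_partialTheta hq (α j : K)).hasSum).mul_left
      (c j : K)).mul_left ((q : K) ^ (N ^ 2))⁻¹
    refine h.congr_fun fun k => ?_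
    push_cast
    field_simp
    ring
  have h := hsum.hasSum.prod_fiberwise hfiber
  have htot := h.unique (hasSum_fintype _)
  rw [hsum.hasSum_iff, htot, ← Finset.mul_sum]
  simp only [mul_sub, Finset.sum_sub_distrib, ← hS]
  simp only [thetaRemainder, Finset.mul_sum, Rat.cast_mul, Rat.cast_inv, Rat.cast_sub,
    Rat.cast_sum, Rat.cast_pow]
  rw [Finset.sum_comm]
  simp only [mul_sub, Finset.mul_sum]
  congr 1
  exact Finset.sum_congr rfl fun i _ => Finset.sum_congr rfl fun j _ => by ring

lemma finite_setOf_le_norm_thetaExponents (hq : ‖(q : K)‖ < 1) (α : J → ℚ) {ε : ℝ} (hε : 0 < ε) :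
    {l : J × ℕ | ε ≤ ‖((α l.1 * q ^ (2 * l.2) : ℚ) : K)‖}.Finite := by
  have hj : ∀ j, {k : ℕ | ε ≤ ‖((α j * q ^ (2 * k) : ℚ) : K)‖}.Finite := by
    intro j
    have hlim : Tendsto (fun k : ℕ => ‖((α j * q ^ (2 * k) : ℚ) : K)‖) atTop (𝓝 0) := by
      have h2 : ‖(q : K)‖ ^ 2 < 1 := pow_lt_one₀ (norm_nonneg _) hq two_ne_zero
      simpa [pow_mul] using
        (tendsto_pow_atTop_nhds_zero_of_lt_one (by positivity) h2).const_mul ‖(α j : K)‖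
    have h := hlim.eventually (gt_mem_nhds hε)
    rw [← Nat.cofinite_eq_atTop, Filter.eventually_cofinite] at h
    simpa using h
  refine (Set.finite_iUnion fun j => (hj j).image (Prod.mk j)).subset ?_
  rintro ⟨j, k⟩ h
  exact Set.mem_iUnion.2 ⟨j, k, h, rfl⟩

theorem exists_recurrenceApply_thetaRemainder_small [CompleteSpace K] [Nonempty J]
    (hq₀ : q ≠ 0) (hq : ‖(q : K)‖ < 1) (hc : ∀ j, c j ≠ 0) (hα : ∀ j, α j ≠ 0)
    (hinj : Function.Injective fun l : J × ℕ => α l.1 * q ^ (2 * l.2))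
    (hS : (S : K) = ∑ j, (c j : K) * ∑' k : ℕ, (q : K) ^ (k ^ 2) * (α j : K) ^ k)
    {B : ℝ} (hB : 0 < B) :
    ∃ P : Polynomial ℚ, ∀ C : ℝ, 0 < C → ∃ m : ℕ,
      recurrenceApply P (thetaRemainder q S c α) m ≠ 0 ∧
      ‖(recurrenceApply P (thetaRemainder q S c α) m : K)‖ < C * B ^ m :=
  exists_recurrenceApply_small (hasSum_thetaRemainder hq₀ hq hS)
    (summable_norm_thetaExponentials hq c α)
    (fun _ => finite_setOf_le_norm_thetaExponents hq α) hinj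
    (fun l => by have := hc l.1; have := hα l.1; positivity)
    (fun l => by have := hα l.1; positivity) hB

end Remainder

/-! ### Denominators of the remainders -/

lemma exists_common_denominator {ι : Type*} (s : Finset ι) (f : ι → ℚ) :
    ∃ D : ℕ, 0 < D ∧ ∀ i ∈ s, (D : ℚ) * f i ∈ (Int.castRingHom ℚ).range := by
  classical
  refine ⟨∏ i ∈ s, (f i).den, Finset.prod_pos fun i _ => (f i).pos, fun i hi => ?_⟩
  rw [← Finset.prod_erase_mul _ _ hi]
  push_cast
  rw [mul_assoc, Rat.den_mul_eq_num]
  exact mul_mem (prod_mem fun _ _ => natCast_mem _ _) (intCast_mem _ _)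

lemma mul_thetaRemainder_mem_range {J : Type*} [Fintype J] {S : ℚ} {c α : J → ℚ} {a b D s : ℕ}
    (ha : 0 < a) (hb : 0 < b) (hα : ∀ j, (D : ℚ) * α j ∈ (Int.castRingHom ℚ).range)
    (hc : ∀ j, (s : ℚ) * c j ∈ (Int.castRingHom ℚ).range)
    (hS : (s : ℚ) * S ∈ (Int.castRingHom ℚ).range) (N : ℕ) :
    (s * D ^ N * a ^ (N ^ 2) * thetaRemainder (a / b) S c α N : ℚ) ∈
      (Int.castRingHom ℚ).range := by
  have ha' : (a : ℚ) ≠ 0 := by positivity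
  have hb' : (b : ℚ) ≠ 0 := by positivity
  have h : (s * D ^ N * a ^ (N ^ 2) * thetaRemainder (a / b) S c α N : ℚ) =
      D ^ N * b ^ (N ^ 2) * (s * S) - ∑ n ∈ Finset.range N,
        D ^ (N - n) * b ^ (N ^ 2 - n ^ 2) * a ^ (n ^ 2) * ∑ j, (s * c j) * (D * α j) ^ n := by
    have hn : ∀ n ∈ Finset.range N,
        (D ^ (N - n) * b ^ (N ^ 2 - n ^ 2) * a ^ (n ^ 2) * ∑ j, (s * c j) * (D * α j) ^ n : ℚ) =
        s * D ^ N * b ^ (N ^ 2) * ((a / b) ^ (n ^ 2) * ∑ j, c j * α j ^ n) := by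
      intro n hn
      have hle : n ≤ N := (Finset.mem_range.1 hn).le
      rw [← pow_sub_mul_pow (D : ℚ) hle, ← pow_sub_mul_pow (b : ℚ) (Nat.pow_le_pow_left hle 2),
        div_pow, Finset.mul_sum, Finset.mul_sum, Finset.mul_sum]
      refine Finset.sum_congr rfl fun j _ => ?_
      rw [mul_pow]
      field_simp
    rw [Finset.sum_congr rfl hn, ← Finset.mul_sum, thetaRemainder, div_pow _ _ (N ^ 2)]
    generalize ∑ n ∈ Finset.range N, ((a : ℚ) / b) ^ (n ^ 2) * ∑ j, c j * α j ^ n = R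
    field_simp
  rw [h]
  refine sub_mem (mul_mem (mul_mem ?_ ?_) hS) (sum_mem fun n _ => mul_mem (mul_mem (mul_mem ?_ ?_)
    ?_) (sum_mem fun j _ => mul_mem (hc j) (pow_mem (hα j) n))) <;>
  exact pow_mem (natCast_mem _ _) _

lemma exists_mul_recurrenceApply_mem_range {v : ℕ → ℚ} {a D s : ℕ} (hD : 0 < D)
    (hs : 0 < s)
    (hv : ∀ N : ℕ, (s * D ^ N * a ^ (N ^ 2) * v N : ℚ) ∈ (Int.castRingHom ℚ).range)
    (P : Polynomial ℚ) :
    ∃ T : ℕ, 0 < T ∧ ∀ m : ℕ, (T * D ^ m * a ^ ((m + P.natDegree) ^ 2) *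
      recurrenceApply P v m : ℚ) ∈ (Int.castRingHom ℚ).range := by
  obtain ⟨A, hA, hAP⟩ := exists_common_denominator (Finset.range (P.natDegree + 1)) P.coeff
  refine ⟨s * A * D ^ P.natDegree, by positivity, fun m => ?_⟩
  rw [recurrenceApply, Finset.mul_sum]
  refine sum_mem fun i hi => ?_
  have hle : i ≤ P.natDegree := Nat.lt_succ_iff.1 (Finset.mem_range.1 hi)
  have hsq : (m + i) ^ 2 ≤ (m + P.natDegree) ^ 2 := Nat.pow_le_pow_left (by omega) 2
  have h : ((s * A * D ^ P.natDegree : ℕ) * D ^ m * a ^ ((m + P.natDegree) ^ 2) *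
      (P.coeff i * v (m + i)) : ℚ) =
      D ^ (P.natDegree - i) * a ^ ((m + P.natDegree) ^ 2 - (m + i) ^ 2) * (A * P.coeff i) *
        (s * D ^ (m + i) * a ^ ((m + i) ^ 2) * v (m + i)) := by
    push_cast
    rw [← pow_sub_mul_pow (D : ℚ) hle, ← pow_sub_mul_pow (a : ℚ) hsq]
    ring
  rw [h]
  exact mul_mem (mul_mem (mul_mem (pow_mem (natCast_mem _ _) _) (pow_mem (natCast_mem _ _) _))
    (hAP i hi)) (hv _)

/-- The exponential rate `D` must not depend on `P`, since `P` is chosen from a rate built on `D`;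
only the constant `T` may depend on `P`. -/
theorem exists_mul_recurrenceApply_thetaRemainder_mem_range {J : Type*} [Fintype J] {a b : ℕ}
    (ha : 0 < a) (hb : 0 < b) (S : ℚ) (c α : J → ℚ) :
    ∃ D : ℕ, 0 < D ∧ ∀ P : Polynomial ℚ, ∃ T : ℕ, 0 < T ∧ ∀ m : ℕ,
      (T * D ^ m * a ^ ((m + P.natDegree) ^ 2) *
        recurrenceApply P (thetaRemainder (a / b) S c α) m : ℚ) ∈ (Int.castRingHom ℚ).range := by
  obtain ⟨D, hD, hα⟩ := exists_common_denominator Finset.univ α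
  -- `Option J` gives one denominator for `S` and all `c j` at once.
  obtain ⟨s, hs, hcS⟩ := exists_common_denominator Finset.univ
    (fun o : Option J => o.elim S c)
  exact ⟨D, hD, exists_mul_recurrenceApply_mem_range hD hs (mul_thetaRemainder_mem_range ha hb
    (fun j => hα j (Finset.mem_univ j)) (fun j => hcS (some j) (Finset.mem_univ _))
    (hcS none (Finset.mem_univ _)))⟩

/-! ### Lower bounds for integers and real growth of the remainders -/

lemma one_le_abs_of_mem_range {r : ℚ} (hr : r ∈ (Int.castRingHom ℚ).range) (hr₀ : r ≠ 0) :
    1 ≤ |r| := by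
  obtain ⟨z, rfl⟩ := hr
  have hz : z ≠ 0 := by rintro rfl; simp at hr₀
  simpa using (by exact_mod_cast Int.one_le_abs hz : (1 : ℚ) ≤ |(z : ℚ)|)

/-- The exact power of `p` in a nonzero integer divides it, hence is at most its absolute value. -/
lemma one_le_abs_mul_padicNorm_of_mem_range (p : ℕ) [Fact p.Prime] {r : ℚ}
    (hr : r ∈ (Int.castRingHom ℚ).range) (hr₀ : r ≠ 0) : 1 ≤ |(r : ℝ)| * ‖(r : ℚ_[p])‖ := by
  obtain ⟨z, rfl⟩ := hr
  have hz : z ≠ 0 := by rintro rfl; simp at hr₀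
  have hp : (0 : ℝ) < p := by exact_mod_cast (Fact.out : p.Prime).pos
  have hz' : (z : ℚ_[p]) ≠ 0 := by exact_mod_cast hz
  have hdvd : ((p : ℤ) ^ padicValInt p z) ∣ z := padicValInt_dvd z
  have hle : (p : ℤ) ^ padicValInt p z ≤ |z| :=
    Int.le_of_dvd (abs_pos.2 hz) ((dvd_abs _ _).2 hdvd)
  have hle' : (p : ℝ) ^ padicValInt p z ≤ |(z : ℝ)| := by exact_mod_cast hle
  have hnorm : ‖(z : ℚ_[p])‖ = ((p : ℝ) ^ padicValInt p z)⁻¹ := by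
    rw [Padic.norm_eq_zpow_neg_valuation hz', Padic.valuation_intCast, zpow_neg, zpow_natCast]
  simp only [eq_intCast, Rat.cast_intCast, hnorm]
  rwa [← div_eq_mul_inv, one_le_div (by positivity)]

/-- Over the reals the theta series need not converge, but the remainder is a finite expression in
which `q ^ (n ^ 2) / q ^ (N ^ 2) ≤ 1` for `n < N`. -/
lemma exists_abs_thetaRemainder_le {J : Type*} [Fintype J] {q : ℚ} (hq : 1 ≤ q) (S : ℚ)
    (c α : J → ℚ) :
    ∃ C₀ C : ℚ, 0 < C₀ ∧ 0 < C ∧ ∀ N, |thetaRemainder q S c α N| ≤ C₀ * C ^ N := by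
  set A : ℚ := 1 + ∑ j, |α j| with hA
  have hA₁ : 1 ≤ A := le_add_of_nonneg_right (Finset.sum_nonneg fun _ _ => abs_nonneg _)
  have hαA : ∀ j, |α j| ≤ A := fun j =>
    (Finset.single_le_sum (f := fun j => |α j|) (fun _ _ => abs_nonneg _)
      (Finset.mem_univ j)).trans (by rw [hA]; linarith)
  set G : ℚ := ∑ j, |c j| with hG
  have hG₀ : 0 ≤ G := Finset.sum_nonneg fun _ _ => abs_nonneg _
  -- The factor `2` absorbs the number of terms through `N ≤ 2 ^ N`.
  refine ⟨|S| + G + 1, 2 * A, by positivity, by positivity, fun N => ?_⟩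
  have hterm : ∀ n ∈ Finset.range N, |q ^ (n ^ 2) * ∑ j, c j * α j ^ n| ≤
      q ^ (N ^ 2) * (G * A ^ N) := by
    intro n hn
    have hle : n ≤ N := (Finset.mem_range.1 hn).le
    rw [abs_mul, abs_of_nonneg (by positivity)]
    refine mul_le_mul (pow_le_pow_right₀ hq (Nat.pow_le_pow_left hle 2)) ?_ (abs_nonneg _)
      (by positivity)
    rw [hG, Finset.sum_mul]
    refine (Finset.abs_sum_le_sum_abs _ _).trans (Finset.sum_le_sum fun j _ => ?_)
    rw [abs_mul, abs_pow]
    exact mul_le_mul_of_nonneg_left ((pow_le_pow_left₀ (abs_nonneg _) (hαA j) n).trans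
      (pow_le_pow_right₀ hA₁ hle)) (abs_nonneg _)
  have hqN : 1 ≤ q ^ (N ^ 2) := one_le_pow₀ hq
  have hbound : |S - ∑ n ∈ Finset.range N, q ^ (n ^ 2) * ∑ j, c j * α j ^ n| ≤
      q ^ (N ^ 2) * (|S| + N * (G * A ^ N)) := by
    refine (abs_sub _ _).trans ?_
    have h1 := (Finset.abs_sum_le_sum_abs _ _).trans (Finset.sum_le_sum hterm)
    rw [Finset.sum_const, Finset.card_range, nsmul_eq_mul] at h1
    have h2 : |S| ≤ q ^ (N ^ 2) * |S| := le_mul_of_one_le_left (abs_nonneg _) hqN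
    linarith
  have hN : (N : ℚ) ≤ 2 ^ N := by exact_mod_cast Nat.lt_two_pow_self.le
  have hAN : 1 ≤ A ^ N := one_le_pow₀ hA₁
  have h2N : (1 : ℚ) ≤ 2 ^ N := one_le_pow₀ (by norm_num)
  rw [thetaRemainder, abs_mul, abs_of_nonneg (by positivity), inv_mul_le_iff₀ (by positivity)]
  refine hbound.trans (mul_le_mul_of_nonneg_left ?_ (by positivity))
  rw [mul_pow]
  have h3 : |S| ≤ |S| * (2 ^ N * A ^ N) :=
    le_mul_of_one_le_right (abs_nonneg _) (one_le_mul_of_one_le_of_one_le h2N hAN)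
  have h4 : N * (G * A ^ N) ≤ 2 ^ N * (G * A ^ N) :=
    mul_le_mul_of_nonneg_right hN (by positivity)
  have h5 : (0 : ℚ) ≤ 2 ^ N * A ^ N := by positivity
  linarith

lemma exists_abs_recurrenceApply_le {v : ℕ → ℚ} {C₀ C : ℚ} (hC₀ : 0 < C₀) (hC : 0 < C)
    (hv : ∀ N, |v N| ≤ C₀ * C ^ N) (P : Polynomial ℚ) :
    ∃ C₁ : ℚ, 0 < C₁ ∧ ∀ m, |recurrenceApply P v m| ≤ C₁ * C ^ m := by
  refine ⟨1 + ∑ i ∈ Finset.range (P.natDegree + 1), |P.coeff i| * (C₀ * C ^ i),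
    by positivity, fun m => ?_⟩
  have h : |recurrenceApply P v m| ≤
      (∑ i ∈ Finset.range (P.natDegree + 1), |P.coeff i| * (C₀ * C ^ i)) * C ^ m := by
    rw [recurrenceApply, Finset.sum_mul]
    refine (Finset.abs_sum_le_sum_abs _ _).trans (Finset.sum_le_sum fun i _ => ?_)
    rw [abs_mul]
    refine (mul_le_mul_of_nonneg_left (hv (m + i)) (abs_nonneg _)).trans (le_of_eq ?_)
    ring
  have : 0 < C ^ m := by positivity
  linarith

/-! ### From theta combinations to small recurrence values -/

section ThetaCombination

variable {K : Type*} [NormedField K] [CharZero K]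

lemma DistinctClasses.injective_mul_pow {m : ℕ} {q : ℚˣ} {ξ : Fin m → ℚˣ}
    (hξ : DistinctClasses q ξ) (hq : ‖((q : ℚ) : K)‖ < 1) :
    Function.Injective fun l : (Fin m × ℤˣ) × ℕ =>
      ((ξ l.1.1 ^ (l.1.2 : ℤ) : ℚˣ) : ℚ) * (q : ℚ) ^ (2 * l.2) := by
  rintro ⟨j, k⟩ ⟨j', k'⟩ h
  have h' : ξ j.1 ^ (j.2 : ℤ) * q ^ (2 * k) = ξ j'.1 ^ (j'.2 : ℤ) * q ^ (2 * k') := by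
    ext
    simpa using h
  have hj : j = j' := by
    refine hξ (QuotientGroup.eq.2 (Subgroup.mem_zpowers_iff.2 ⟨2 * k - 2 * k', ?_⟩))
    rw [eq_inv_mul_iff_mul_eq, zpow_sub, ← mul_assoc, mul_inv_eq_iff_eq_mul]
    exact_mod_cast h'
  subst hj
  have hpow : (q : ℚ) ^ (2 * k) = (q : ℚ) ^ (2 * k') := by
    exact_mod_cast congrArg Units.val (mul_left_cancel h')
  -- Norm below `1` makes the powers of `q` distinct.
  have hnorm : ‖((q : ℚ) : K)‖ ^ (2 * k) = ‖((q : ℚ) : K)‖ ^ (2 * k') := by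
    rw [← norm_pow, ← norm_pow]
    exact_mod_cast congrArg (fun r : ℚ => ‖(r : K)‖) hpow
  have hpos : 0 < ‖((q : ℚ) : K)‖ := norm_pos_iff.2 (by exact_mod_cast q.ne_zero)
  have := (pow_right_strictAnti₀ hpos hq).injective hnorm
  simp only [Prod.mk.injEq, true_and]
  omega

variable [CompleteSpace K]

lemma sum_mul_jacobiThetaSeries {m : ℕ} {q : ℚˣ} (hq : ‖((q : ℚ) : K)‖ < 1) (ξ γ : Fin m → ℚˣ) :
    ∑ i, ((γ i : ℚ) : K) * jacobiThetaSeries ((ξ i : ℚ) : K) ((q : ℚ) : K) =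
      (∑ j : Fin m × ℤˣ, ((γ j.1 : ℚ) : K) * ∑' k : ℕ, ((q : ℚ) : K) ^ (k ^ 2) *
        (((ξ j.1 ^ (j.2 : ℤ) : ℚˣ) : ℚ) : K) ^ k) - ((∑ i, (γ i : ℚ) : ℚ) : K) := by
  rw [Fintype.sum_prod_type, Rat.cast_sum, ← Finset.sum_sub_distrib]
  refine Finset.sum_congr rfl fun i _ => ?_
  rw [jacobiThetaSeries, (hasSum_thetaTerm hq _).tsum_eq]
  simp only [UnitsInt.univ]
  rw [Finset.sum_pair (by decide)]
  simp only [Units.val_one, Units.val_neg, zpow_one, zpow_neg, Units.val_inv_eq_inv_val,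
    Rat.cast_inv]
  ring

/-- If a combination of theta values is rational, then suitable linear recurrence operators take
arbitrarily small nonzero values on the remainders of its expansion. -/
theorem exists_small_of_theta_combination_rational {m : ℕ} (hm : 0 < m) {q : ℚˣ}
    {ξ : Fin m → ℚˣ} (γ : Fin m → ℚˣ) (hξ : DistinctClasses q ξ) (hq : ‖((q : ℚ) : K)‖ < 1)
    (h : ∑ i, ((γ i : ℚ) : K) * jacobiThetaSeries ((ξ i : ℚ) : K) ((q : ℚ) : K) ∈
      Set.range ((↑) : ℚ → K)) :
    ∃ (S : ℚ) (c α : Fin m × ℤˣ → ℚ), ∀ B : ℝ, 0 < B → ∃ P : Polynomial ℚ, ∀ C : ℝ, 0 < C →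
      ∃ n : ℕ, recurrenceApply P (thetaRemainder q S c α) n ≠ 0 ∧
        ‖(recurrenceApply P (thetaRemainder q S c α) n : K)‖ < C * B ^ n := by
  obtain ⟨r, hr⟩ := h
  rw [sum_mul_jacobiThetaSeries hq] at hr
  have : Nonempty (Fin m × ℤˣ) := ⟨⟨⟨0, hm⟩, 1⟩⟩
  have hS : ((r + ∑ i, (γ i : ℚ) : ℚ) : K) = ∑ j : Fin m × ℤˣ, ((γ j.1 : ℚ) : K) *
      ∑' k : ℕ, ((q : ℚ) : K) ^ (k ^ 2) * (((ξ j.1 ^ (j.2 : ℤ) : ℚˣ) : ℚ) : K) ^ k := by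
    rw [Rat.cast_add, hr, sub_add_cancel]
  have hsmall := fun (B : ℝ) (hB : 0 < B) => exists_recurrenceApply_thetaRemainder_small
    q.ne_zero hq (fun j : Fin m × ℤˣ => (γ j.1).ne_zero)
    (fun j : Fin m × ℤˣ => (ξ j.1 ^ (j.2 : ℤ)).ne_zero) (hξ.injective_mul_pow hq) hS hB
  exact ⟨_, _, _, hsmall⟩

end ThetaCombination

/-! ### The real and `p`-adic contradictions -/

theorem irrational_theta_combination {m : ℕ} (hm : 0 < m) {q : ℚˣ} {ξ : Fin m → ℚˣ}
    (γ : Fin m → ℚˣ) (hξ : DistinctClasses q ξ) {n : ℕ} (hn : 1 < n) (hqn : (q : ℚ) = 1 / n)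
    (hq : ‖((q : ℚ) : ℝ)‖ < 1) :
    Irrational (∑ i, ((γ i : ℚ) : ℝ) * jacobiThetaSeries ((ξ i : ℚ) : ℝ) ((q : ℚ) : ℝ)) := by
  intro h
  obtain ⟨S, c, α, hsmall⟩ := exists_small_of_theta_combination_rational hm γ hξ hq h
  obtain ⟨D, hD, hint⟩ := exists_mul_recurrenceApply_thetaRemainder_mem_range
    one_pos (zero_lt_one.trans hn) S c α
  rw [Nat.cast_one, ← hqn] at hint
  -- Rate `1 / D` offsets `D ^ k`, and the constant `1 / T` then offsets `T`.
  obtain ⟨P, hP⟩ := hsmall (1 / D) (by positivity)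
  obtain ⟨T, hT, hTm⟩ := hint P
  obtain ⟨k, hk₀, hk⟩ := hP (1 / T) (by positivity)
  set u := recurrenceApply P (thetaRemainder q S c α) k
  have h1 := one_le_abs_of_mem_range (hTm k) (by positivity)
  rw [one_pow, mul_one, abs_mul, abs_of_pos (by positivity)] at h1
  have h1' : (1 : ℝ) ≤ T * D ^ k * |(u : ℝ)| := by exact_mod_cast h1
  rw [Real.norm_eq_abs, one_div_pow, one_div_mul_one_div, lt_div_iff₀ (by positivity)] at hk
  linarith

theorem padic_theta_combination_notMem_range {m : ℕ} (hm : 0 < m) {q : ℚˣ} {ξ : Fin m → ℚˣ}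
    (γ : Fin m → ℚˣ) (hξ : DistinctClasses q ξ) (p : ℕ) [Fact p.Prime] (hq₁ : 1 < (q : ℚ)) {k : ℕ}
    (hqk : (q : ℚ).num = (p : ℤ) ^ k) (hq : ‖((q : ℚ) : ℚ_[p])‖ < 1) :
    (∑ i, ((γ i : ℚ) : ℚ_[p]) * jacobiThetaSeries ((ξ i : ℚ) : ℚ_[p]) ((q : ℚ) : ℚ_[p])) ∉
        Set.range ((↑) : ℚ → ℚ_[p]) := by
  intro h
  have hp : 0 < p := (Fact.out : p.Prime).pos
  obtain ⟨S, c, α, hsmall⟩ := exists_small_of_theta_combination_rational hm γ hξ hq h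
  obtain ⟨D, hD, hint⟩ := exists_mul_recurrenceApply_thetaRemainder_mem_range
    (pow_pos hp k) (q : ℚ).pos S c α
  have hqab : (((p ^ k : ℕ) : ℚ) / ((q : ℚ).den : ℚ)) = q := by
    have hnum : ((q : ℚ).num : ℚ) = (p ^ k : ℕ) := by exact_mod_cast hqk
    rw [← hnum, Rat.num_div_den]
  rw [hqab] at hint
  obtain ⟨C₀, C, hC₀, hC, hv⟩ := exists_abs_thetaRemainder_le hq₁.le S c α
  have hCr : (0 : ℝ) < C := by exact_mod_cast hC
  -- The `p`-adic decay must offset both the denominator growth `D` and the real growth `C` of the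
  -- same quantity.
  obtain ⟨P, hP⟩ := hsmall (1 / (D * C)) (by positivity)
  obtain ⟨T, hT, hTm⟩ := hint P
  obtain ⟨C₁, hC₁, hu⟩ := exists_abs_recurrenceApply_le hC₀ hC hv P
  have hC₁r : (0 : ℝ) < C₁ := by exact_mod_cast hC₁
  obtain ⟨n, hn₀, hn⟩ := hP (1 / (T * C₁)) (by positivity)
  have hun := hu n
  have h1 := one_le_abs_mul_padicNorm_of_mem_range p (hTm n) (by positivity)
  set u := recurrenceApply P (thetaRemainder q S c α) n
  have hun' : |(u : ℝ)| ≤ C₁ * C ^ n := by exact_mod_cast hun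
  set e := (n + P.natDegree) ^ 2
  have hpe : ‖(((T : ℚ) * D ^ n * ((p ^ k : ℕ) : ℚ) ^ e * u : ℚ) : ℚ_[p])‖ ≤
      (((p : ℝ) ^ k) ^ e)⁻¹ * ‖(u : ℚ_[p])‖ := by
    have hTD : ‖((T * D ^ n : ℕ) : ℚ_[p])‖ ≤ 1 := by
      simpa using Padic.norm_int_le_one (p := p) ((T * D ^ n : ℕ) : ℤ)
    push_cast at hTD ⊢
    rw [norm_mul, norm_mul, norm_pow, norm_pow, Padic.norm_p, inv_pow, inv_pow]
    exact mul_le_mul_of_nonneg_right (mul_le_of_le_one_left (by positivity) hTD) (norm_nonneg _)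
  have hreal : |(((T : ℚ) * D ^ n * ((p ^ k : ℕ) : ℚ) ^ e * u : ℚ) : ℝ)| =
      T * D ^ n * ((p : ℝ) ^ k) ^ e * |(u : ℝ)| := by
    push_cast
    rw [abs_mul, abs_of_nonneg (by positivity)]
  rw [hreal] at h1
  -- The quadratic-exponent factor `(p ^ k) ^ e` cancels against its `p`-adic norm; this is where
  -- the numerator being a power of `p` matters.
  have h2 : 1 ≤ (T * D ^ n * |(u : ℝ)|) * ‖(u : ℚ_[p])‖ := by
    refine (h1.trans (mul_le_mul_of_nonneg_left hpe (by positivity))).trans (le_of_eq ?_)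
    have : ((p : ℝ) ^ k) ^ e ≠ 0 := by positivity
    field_simp
  have h3 : 1 ≤ (T * D ^ n * (C₁ * C ^ n)) * ‖(u : ℚ_[p])‖ :=
    h2.trans (by gcongr)
  have h4 : (1 / (T * C₁) * (1 / (D * C)) ^ n : ℝ) = 1 / (T * D ^ n * (C₁ * C ^ n) : ℝ) := by
    rw [one_div_pow, mul_pow, one_div_mul_one_div]
    ring
  rw [h4, lt_div_iff₀ (by positivity)] at hn
  linarith

theorem mainTheorem8 (m : ℕ) (hm : 0 < m) (q : ℚˣ) (ξ γ : Fin m → ℚˣ)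
    (hξ : DistinctClasses q ξ) :
    ((∃ n : ℕ, 1 < n ∧ (q : ℚ) = 1 / (n : ℚ)) →
      (∀ i, Summable (thetaTerm ((ξ i : ℚ) : ℝ) ((q : ℚ) : ℝ))) ∧
      Irrational (∑ i, ((γ i : ℚ) : ℝ) * jacobiThetaSeries ((ξ i : ℚ) : ℝ) ((q : ℚ) : ℝ))) ∧
    (∀ (p : ℕ) [Fact p.Prime],
      1 < (q : ℚ) → (∃ k : ℕ, 0 < k ∧ (q : ℚ).num = (p : ℤ) ^ k) →
      (∀ i, Summable (thetaTerm ((ξ i : ℚ) : ℚ_[p]) ((q : ℚ) : ℚ_[p]))) ∧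
      (∑ i, ((γ i : ℚ) : ℚ_[p]) * jacobiThetaSeries ((ξ i : ℚ) : ℚ_[p]) ((q : ℚ) : ℚ_[p])) ∉
        Set.range ((↑) : ℚ → ℚ_[p])) := by
  constructor
  · rintro ⟨n, hn, hqn⟩
    have hq : ‖((q : ℚ) : ℝ)‖ < 1 := by
      have hn' : (1 : ℝ) < n := by exact_mod_cast hn
      rw [hqn, Real.norm_of_nonneg (by positivity)]
      push_cast
      exact (div_lt_one (by positivity)).2 hn'
    exact ⟨fun i => (hasSum_thetaTerm hq _).summable,
      irrational_theta_combination hm γ hξ hn hqn hq⟩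
  · rintro p _ hq₁ ⟨k, hk, hqk⟩
    have hq : ‖((q : ℚ) : ℚ_[p])‖ < 1 := by
      have hden : ‖((q : ℚ).den : ℚ_[p])‖ = 1 := by
        rw [Padic.norm_natCast_eq_one_iff]
        have h := (q : ℚ).reduced
        rw [hqk, Int.natAbs_pow, Int.natAbs_natCast] at h
        exact Nat.Coprime.coprime_dvd_left (dvd_pow_self p hk.ne') h
      rw [← Rat.num_div_den (q : ℚ), hqk]
      push_cast
      rw [norm_div, hden, div_one, norm_pow]
      exact pow_lt_one₀ (norm_nonneg _) Padic.norm_p_lt_one hk.ne'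
    exact ⟨fun i => (hasSum_thetaTerm hq _).summable,
      padic_theta_combination_notMem_range hm γ hξ p hq₁ hqk hq⟩
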